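/- \textbf{Setting.} Let $\mathcal S,\mathcal A$ be finite non-empty sets, $S=|\mathcal S|$, $A=|\mathcal A|$, $s_0\in\mathcal S$, $H\ge 1$, and let $P=\{P_h\}_{h=0}^{H-1}$ be transition dynamics, $P_h(\cdot\mid s,a)$ being a probability distribution on $\mathcal S$. For a stochastic Markov policy $\pi$ (distributions $\pi_h(\cdot\mid s)$ on $\mathcal A$) and dynamics $Q$, let $q_h(s\mid\pi,Q)$ be the probability that an episode started in $s_0$ is in state $s$ at time $h$, and for $r=\{r_h\}_{h=0}^{H-1}$, $r_h:\mathcal S\times\mathcal A\to[0,1]$, let $V^\pi_{Q,r}=\mathbb E_{Q,\pi}\bigl[\sum_{h=0}^{H-1}r_h(s_h,a_h)\bigr]$. \textbf{Algorithm} (MARFE with $m$ agents, $H$ phases and threshold $\beta$). It learns dynamics $\widehat P=\{\widehat P_h\}_{h=0}^{H-1}$ on $\mathcal S\cup\{s_{\mathrm{sink}}\}$, where $s_{\mathrm{sink}}$ is absorbing and has reward $0$. In phase $i=0,\dots,H-1$, for each $s\in\mathcal S$ let $\widehat\pi^{i,s}$ be a deterministic Markov policy maximizing $q_i(s\mid\pi,\{\widehat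 P_k\}_{k<i})$, ties being broken arbitrarily, and let $\widehat{\mathcal S}_i=\{s\in\mathcal S: q_i(s\mid\widehat\pi^{i,s},\{\widehat P_k\}_{k<i})\ge\beta\}$. The agents are partitioned into $|\widehat{\mathcal S}_i|A$ groups of equal size, one for each $(s,a)\in\widehat{\mathcal S}_i\times\mathcal A$ (up to rounding: each group has at least $\lfloor m/(|\widehat{\mathcal S}_i|A)\rfloor$ agents). Independently of each other, the agents of the group of $(s,a)$ run one episode of the true dynamics $P$ with the policy $\widehat\pi^{i,s}$, modified to take action $a$ in state $s$ at time $i$. With $N_i(s,a,s')$ the number of agents of phase $i$ with $s_i=s$, $a_i=a$, $s_{i+1}=s'$ and $N_i(s,a)=\sum_{s'}N_i(s,a,s')$, put $\widehat P_i(s'\mid s,a)=N_i(s,a,s')/N_i(s,a)$ for $s\in\widehat{\mathcal S}_i$, $s'\in\mathcal S$, and let every $s\notin\widehat{\mathcal S}_i$ (and every $(s,a)$ with $N_i(s,a)=0$) move to $s_{\mathrm{sink}}$ with probability $1$. The output is $\widehat P$. \textbf{Claim.} Run MARFE with $\beta=\epsilon/(2H^2S)$. (1) There is a universal constant $C>0$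 such that, for all $\epsilon,\delta\in(0,1)$, if $$m\ge C\,\frac{S^5H^6A\,(\log(SHA/\delta)+S)}{\epsilon^2},$$ then with probability at least $1-\delta$, simultaneously for every stochastic Markov policy $\pi$ and every reward function $r=\{r_h\}$ with values in $[0,1]$, $$\bigl|V^\pi_{P,r}-V^\pi_{\widehat P,r}\bigr|\le \epsilon/2 .$$ (2) For all $\epsilon,\delta>0$ and every integer $M\ge m$, with $\delta'=\frac{\delta}{SHA}\cdot\frac1M$, if $$m\ge 89\,\frac{S^5H^6A\,(\log(1/\delta')+2S)}{\epsilon^2},$$ then with probability higher than $1-\delta$, simultaneously for every such $\pi$ and $r$, $$\bigl|V^\pi_{P,r}-V^\pi_{\widehat P,r}\bigr|\le 2\epsilon .$$ -/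

import Mathlib

open scoped ENNReal

noncomputable section

namespace Marfe

/-- Time-dependent transition dynamics: `P h x a` is the law of the state at time `h + 1` when
action `a` is taken in state `x` at time `h`. In an episode of horizon `H` only the entries
`h < H` are ever used. -/
abbrev Dynamics (X A : Type*) := ℕ → X → A → PMF X

/-- Stochastic Markov policies: `π h x` is the law of the action taken in state `x` at time `h`. -/
abbrev Policy (X A : Type*) := ℕ → X → PMF A

/-- Deterministic Markov policies. -/
abbrev DetPolicy (X A : Type*) := ℕ → X → A

/-- A deterministic policy, seen as a stochastic one. -/
def DetPolicy.toPolicy {X A : Type*} (π : DetPolicy X A) : Policy X A :=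
  fun h x => PMF.pure (π h x)

/-- Trajectories `(s_0, a_0, s_1, …, a_{n-1}, s_n)`: the states and the actions. -/
abbrev Trajectory (X A : Type*) (n : ℕ) := (Fin (n + 1) → X) × (Fin n → A)

/-- The law of the first `n` steps of an episode started in `x₀`, under dynamics `P` and
policy `π`. -/
def trajLaw {X A : Type*} (P : Dynamics X A) (π : Policy X A) (x₀ : X) :
    (n : ℕ) → PMF (Trajectory X A n)
  | 0 => PMF.pure (fun _ => x₀, Fin.elim0)
  | n + 1 =>
      (trajLaw P π x₀ n).bind fun τ =>
        (π n (τ.1 (Fin.last n))).bind fun a =>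
          (P n (τ.1 (Fin.last n)) a).map fun x' =>
            ((Fin.snoc τ.1 x' : Fin (n + 1 + 1) → X), (Fin.snoc τ.2 a : Fin (n + 1) → A))

/-- The probability that a random element with law `p` has the property `E`. -/
def prob {X : Type*} (p : PMF X) (E : X → Prop) : ℝ :=
  (p.toOuterMeasure {x | E x}).toReal

/-- The occupancy measure `q_h(x ∣ π, P)`: the probability that the state at time `h` is `x`.
It involves only the dynamics at times `k < h`. -/
def occupancy {X A : Type*} (P : Dynamics X A) (π : Policy X A) (x₀ : X) (h : ℕ) (x : X) : ℝ :=
  prob (trajLaw P π x₀ h) fun τ => τ.1 (Fin.last h) = x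

/-- The value `V^π_{P,r}`: the expected sum of the rewards `r_h(s_h, a_h)`, `0 ≤ h < H`. -/
def value {X A : Type*} [Fintype X] [Fintype A] (H : ℕ) (P : Dynamics X A) (x₀ : X)
    (r : ℕ → X → A → ℝ) (π : Policy X A) : ℝ :=
  ∑ τ : Trajectory X A H,
    (trajLaw P π x₀ H τ).toReal * ∑ h : Fin H, r h (τ.1 h.castSucc) (τ.2 h)

/-! The learned dynamics live on `Option S`; the element `none` is the sink state. -/

/-- A policy on `S`, extended to the sink; the action chosen there is irrelevant. -/
def Policy.withSink {S A : Type*} [Nonempty A] (π : Policy S A) : Policy (Option S) A :=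
  fun h x => x.elim (PMF.pure (Classical.arbitrary A)) (π h)

/-- A reward function on `S`, extended by zero to the sink. -/
def rewardWithSink {S A : Type*} (r : ℕ → S → A → ℝ) : ℕ → Option S → A → ℝ :=
  fun h x a => x.elim 0 fun s => r h s a

/-- The joint law of independent random elements with laws `p j`. -/
def indep {m : ℕ} {X : Type*} [Fintype X] (p : Fin m → PMF X) : PMF (Fin m → X) :=
  PMF.ofFintype (fun f => ∏ j, p j (f j)) <| by
    have h := Finset.prod_univ_sum (fun _ : Fin m => (Finset.univ : Finset X))
      (fun j x => p j x)
    rw [Fintype.piFinset_univ] at h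
    rw [← h]
    refine Finset.prod_eq_one fun j _ => ?_
    rw [← tsum_fintype (L := .unconditional X)]
    exact (p j).tsum_coe

section Algorithm

variable {S A : Type*} [Fintype S] [DecidableEq S] [Fintype A] [DecidableEq A] [Nonempty A]

/-- A planning rule: given learned dynamics `Phat`, a time `i` and a state `s`, a deterministic
policy to be used for reaching `s` at time `i`. -/
abbrev Planner (S A : Type*) := Dynamics (Option S) A → ℕ → S → DetPolicy S A

/-- `plan Phat i s ∈ argmax_π q_i(s ∣ π, Phat)`, with an arbitrary rule to break ties. -/
def IsOptimalPlanner (s₀ : S) (plan : Planner S A) : Prop :=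
  ∀ (Phat : Dynamics (Option S) A) (i : ℕ) (s : S) (π : DetPolicy S A),
    occupancy Phat π.toPolicy.withSink (some s₀) i (some s) ≤
      occupancy Phat (plan Phat i s).toPolicy.withSink (some s₀) i (some s)

/-- The active states at time `i`: those which the planned policy reaches at time `i` with
probability at least `β` under the learned dynamics. -/
def activeStates (s₀ : S) (β : ℝ) (plan : Planner S A) (Phat : Dynamics (Option S) A) (i : ℕ) :
    Finset S :=
  Finset.univ.filter fun s =>
    β ≤ occupancy Phat (plan Phat i s).toPolicy.withSink (some s₀) i (some s)

/-- A rule that assigns, in phase `i` with active set `T`, each of `m` agents to a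
state-action pair. -/
abbrev Grouping (S A : Type*) (m : ℕ) := ℕ → Finset S → Fin m → S × A

/-- The agents are split into `|T| |A|` groups of equal size, one for each `(s, a) ∈ T × A`. When
`|T| |A|` does not divide `m`, every group has at least `⌊m / (|T| |A|)⌋` agents and the
remaining ones join groups in any way. Nothing is asked when there is no active state. -/
def IsEqualGrouping {m : ℕ} (grp : Grouping S A m) : Prop :=
  ∀ (i : ℕ) (T : Finset S), T.Nonempty →
    (∀ j, (grp i T j).1 ∈ T) ∧
    ∀ s ∈ T, ∀ a : A,
      m / (T.card * Fintype.card A) ≤ (Finset.univ.filter fun j => grp i T j = (s, a)).card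

/-- Follow `π`, except for taking action `a` in state `s` at time `i`. -/
def forceAction (π : DetPolicy S A) (i : ℕ) (s : S) (a : A) : DetPolicy S A :=
  fun h s' => if h = i ∧ s' = s then a else π h s'

/-- `N_i(s, a, s')`: the number of agents with `s_i = s`, `a_i = a`, `s_{i+1} = s'`. -/
def count {m H : ℕ} (D : Fin m → Trajectory S A H) (i : Fin H) (s : S) (a : A) (s' : S) : ℕ :=
  (Finset.univ.filter fun j =>
    (D j).1 i.castSucc = s ∧ (D j).2 i = a ∧ (D j).1 i.succ = s').card

/-- The estimate of the transitions at time `i` from the data `D` of phase `i`: the empirical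
distribution `N_i(s, a, s') / N_i(s, a)` on the active states `T`; the other states and the sink
go to the sink (so does a pair without any sample, where the quotient is undefined). -/
def empirical {m H : ℕ} (T : Finset S) (D : Fin m → Trajectory S A H) (i : Fin H) :
    Option S → A → PMF (Option S)
  | none, _ => PMF.pure none
  | some s, a =>
      if hs : s ∈ T ∧ ∑ s', count D i s a s' ≠ 0 then
        (PMF.normalize (fun s' => (count D i s a s' : ℝ≥0∞))
          (by
            rw [tsum_fintype, ← Nat.cast_sum]
            exact_mod_cast hs.2)
          (by
            rw [tsum_fintype, ← Nat.cast_sum]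
            exact ENNReal.natCast_ne_top _)).map some
      else PMF.pure none

/-- The law of the trajectories of the `m` agents in phase `i`: independently, agent `j` in the
group of `(s, a)` runs in the true environment `P` the policy planned for reaching `s` at time
`i`, with action `a` in state `s` at time `i`. -/
def phaseData (P : Dynamics S A) (s₀ : S) (H : ℕ) {m : ℕ} (β : ℝ) (plan : Planner S A)
    (grp : Grouping S A m) (Phat : Dynamics (Option S) A) (i : ℕ) :
    PMF (Fin m → Trajectory S A H) :=
  indep fun j =>
    let g := grp i (activeStates s₀ β plan Phat i) j
    trajLaw P (forceAction (plan Phat i g.1) i g.1 g.2).toPolicy s₀ H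

/-- The law of the dynamics learned in the first `i` phases (phases `0, …, i - 1`). Phase `i` uses
the dynamics learned at the times `k < i` and fills in the transitions at time `i`; the entries
not learned yet are place holders. -/
def marfeRun (P : Dynamics S A) (s₀ : S) (H : ℕ) {m : ℕ} (β : ℝ) (plan : Planner S A)
    (grp : Grouping S A m) : (i : ℕ) → i ≤ H → PMF (Dynamics (Option S) A)
  | 0, _ => PMF.pure fun _ _ _ => PMF.pure none
  | i + 1, hi =>
      (marfeRun P s₀ H β plan grp i (Nat.le_of_succ_le hi)).bind fun Phat =>
        (phaseData P s₀ H β plan grp Phat i).map fun D =>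
          Function.update Phat i (empirical (activeStates s₀ β plan Phat i) D ⟨i, hi⟩)

/-- The law of the output `Phat` of MARFE with `H` phases, `m` agents and threshold `β`. -/
def marfe (P : Dynamics S A) (s₀ : S) (H : ℕ) {m : ℕ} (β : ℝ) (plan : Planner S A)
    (grp : Grouping S A m) : PMF (Dynamics (Option S) A) :=
  marfeRun P s₀ H β plan grp H le_rfl

/-- For all stochastic Markov policies and all rewards with values in `[0, 1]`, simultaneously,
the values under `P` and under `Phat` differ by at most `η`. -/
def ValuesClose (H : ℕ) (P : Dynamics S A) (s₀ : S) (η : ℝ) (Phat : Dynamics (Option S) A) :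
    Prop :=
  ∀ (π : Policy S A) (r : ℕ → S → A → ℝ),
    (∀ h < H, ∀ s a, r h s a ∈ Set.Icc (0 : ℝ) 1) →
      |value H P s₀ r π - value H Phat (some s₀) (rewardWithSink r) π.withSink| ≤ η

end Algorithm

end Marfe

end

/-! Call the learned dynamics accurate when, at each learned time, the transitions from every active
`s` are within t(s) = β / (4H √(S q(s))) of the truth in total variation, where q(s) ≥ β is the
largest probability of reaching `s` under the learned dynamics.

Accuracy suffices for the values. Any policy reaches `s` with learned probability at most q(s), so
by Cauchy-Schwarz the transition errors, weighted by its learned occupancies, add up to at most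
β/(4H) per step. The inactive states cost at most Sβ more per step
(`sum_occupancy_mul_tolerance_le`, `Accurate.stateExpect_bounds`). Summing over times gives H²Sβ =
ε/2 (`Accurate.valuesClose`).

Accuracy propagates from phase to phase. Sending inactive states to the sink only removes mass, so
the learned probability of reaching `s` exceeds the true one by at most β/4: the planned policy
really reaches `s` with probability at least 3q(s)/4 (`Accurate.plannedOccupancy_le`). A smaller
q(s) means fewer samples but also a looser tolerance, and the two effects cancel. Concentration is
an exponential moment bound for "successes minus (mean + t) times visits", which avoids conditioning
on the random number of visits (`expect_exp_excess_le`). A union bound over states, actions, subsets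
of states and phases concludes. -/

namespace Marfe

/-- The expectation of `f` under a law `p` on a finite type. -/
noncomputable def expect {X : Type*} [Fintype X] (p : PMF X) (f : X → ℝ) : ℝ :=
  ∑ x, (p x).toReal * f x

/-! ### Expectations under laws on finite types. -/

section Expect

variable {X Y : Type*} [Fintype X] [Fintype Y]

theorem sum_toReal_eq_one (p : PMF X) : ∑ x, (p x).toReal = 1 := by
  rw [← ENNReal.toReal_sum fun x _ => p.apply_ne_top x, ← tsum_fintype (L := .unconditional X),
    p.tsum_coe, ENNReal.toReal_one]

theorem expect_const (p : PMF X) (c : ℝ) : expect p (fun _ => c) = c := by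
  rw [expect, ← Finset.sum_mul, sum_toReal_eq_one, one_mul]

theorem expect_mono (p : PMF X) {f g : X → ℝ} (h : ∀ x, f x ≤ g x) : expect p f ≤ expect p g :=
  Finset.sum_le_sum fun x _ => mul_le_mul_of_nonneg_left (h x) ENNReal.toReal_nonneg

theorem expect_nonneg (p : PMF X) {f : X → ℝ} (h : ∀ x, 0 ≤ f x) : 0 ≤ expect p f :=
  Finset.sum_nonneg fun x _ => mul_nonneg ENNReal.toReal_nonneg (h x)

theorem expect_le_const (p : PMF X) {f : X → ℝ} {c : ℝ} (h : ∀ x, f x ≤ c) : expect p f ≤ c :=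
  (expect_mono p h).trans_eq (expect_const p c)

theorem const_le_expect (p : PMF X) {f : X → ℝ} {c : ℝ} (h : ∀ x, c ≤ f x) : c ≤ expect p f :=
  (expect_const p c).symm.trans_le (expect_mono p h)

theorem expect_add (p : PMF X) (f g : X → ℝ) :
    expect p (fun x => f x + g x) = expect p f + expect p g := by
  simp only [expect, mul_add, Finset.sum_add_distrib]

theorem expect_sub (p : PMF X) (f g : X → ℝ) :
    expect p (fun x => f x - g x) = expect p f - expect p g := by
  simp only [expect, mul_sub, Finset.sum_sub_distrib]

theorem expect_mul_const (p : PMF X) (f : X → ℝ) (c : ℝ) :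
    expect p (fun x => f x * c) = expect p f * c := by
  simp only [expect, Finset.sum_mul, mul_assoc]

theorem expect_sum {ι : Type*} (p : PMF X) (s : Finset ι) (f : ι → X → ℝ) :
    expect p (fun x => ∑ i ∈ s, f i x) = ∑ i ∈ s, expect p (f i) := by
  simp only [expect, Finset.mul_sum]
  exact Finset.sum_comm

theorem expect_pure (x : X) (f : X → ℝ) : expect (PMF.pure x) f = f x := by
  classical
  rw [expect, Finset.sum_eq_single x]
  · simp
  · intro y _ hy
    simp [PMF.pure_apply, hy]
  · simp

theorem expect_bind (p : PMF X) (g : X → PMF Y) (f : Y → ℝ) :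
    expect (p.bind g) f = expect p fun x => expect (g x) f := by
  have h : ∀ y, ((p.bind g) y).toReal = ∑ x, (p x).toReal * (g x y).toReal := fun y => by
    rw [PMF.bind_apply, tsum_fintype, ENNReal.toReal_sum fun x _ =>
      ENNReal.mul_ne_top (p.apply_ne_top x) ((g x).apply_ne_top y)]
    simp only [ENNReal.toReal_mul]
  simp only [expect, h, Finset.sum_mul, Finset.mul_sum, mul_assoc]
  exact Finset.sum_comm

theorem expect_map (p : PMF X) (g : X → Y) (f : Y → ℝ) :
    expect (p.map g) f = expect p fun x => f (g x) := by
  rw [PMF.map, expect_bind]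
  simp only [Function.comp_apply, expect_pure]

open Classical in
theorem prob_eq_expect (p : PMF X) (E : X → Prop) :
    prob p E = expect p fun x => if E x then 1 else 0 := by
  rw [prob, PMF.toOuterMeasure_apply, tsum_fintype, ENNReal.toReal_sum, expect]
  · refine Finset.sum_congr rfl fun x _ => ?_
    by_cases h : E x <;> simp [Set.indicator, h]
  · intro x _
    by_cases h : E x <;> simp [Set.indicator, h, p.apply_ne_top]

end Expect

theorem occupancy_nonneg {X A : Type*} (P : Dynamics X A) (π : Policy X A) (x₀ : X) (n : ℕ) (x : X) :
    0 ≤ occupancy P π x₀ n x :=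
  ENNReal.toReal_nonneg

/-! ### Marginals of trajectories and the value as a sum over times. -/

section Trajectory

variable {X A : Type*} [Fintype X] [Fintype A]

/-- The expectation of `f (s_n)`, the state after `n` steps of an episode. -/
noncomputable def stateExpect (P : Dynamics X A) (π : Policy X A) (x₀ : X) (n : ℕ) (f : X → ℝ) :
    ℝ :=
  expect (trajLaw P π x₀ n) fun τ => f (τ.1 (Fin.last n))

/-- The expectation of `f (s_{n + 1})` as a function of the state `s_n`. -/
noncomputable def step (P : Dynamics X A) (π : Policy X A) (n : ℕ) (f : X → ℝ) (x : X) : ℝ :=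
  expect (π n x) fun a => expect (P n x a) f

theorem expect_trajLaw_succ (P : Dynamics X A) (π : Policy X A) (x₀ : X) (n : ℕ)
    (F : Trajectory X A (n + 1) → ℝ) :
    expect (trajLaw P π x₀ (n + 1)) F =
      expect (trajLaw P π x₀ n) fun τ => expect (π n (τ.1 (Fin.last n))) fun a =>
        expect (P n (τ.1 (Fin.last n)) a) fun x =>
          F ((Fin.snoc τ.1 x : Fin (n + 1 + 1) → X), (Fin.snoc τ.2 a : Fin (n + 1) → A)) := by
  rw [trajLaw, expect_bind]
  simp only [expect_bind, expect_map]

theorem stateExpect_zero (P : Dynamics X A) (π : Policy X A) (x₀ : X) (f : X → ℝ) :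
    stateExpect P π x₀ 0 f = f x₀ := by
  rw [stateExpect, trajLaw, expect_pure]

theorem stateExpect_succ (P : Dynamics X A) (π : Policy X A) (x₀ : X) (n : ℕ) (f : X → ℝ) :
    stateExpect P π x₀ (n + 1) f = stateExpect P π x₀ n (step P π n f) := by
  rw [stateExpect, expect_trajLaw_succ]
  simp only [Fin.snoc_last]
  rfl

theorem stateExpect_mono (P : Dynamics X A) (π : Policy X A) (x₀ : X) (n : ℕ) {f g : X → ℝ}
    (h : ∀ x, f x ≤ g x) : stateExpect P π x₀ n f ≤ stateExpect P π x₀ n g :=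
  expect_mono _ fun _ => h _

theorem occupancy_eq_stateExpect [DecidableEq X] (P : Dynamics X A) (π : Policy X A) (x₀ : X)
    (n : ℕ) (x : X) :
    occupancy P π x₀ n x = stateExpect P π x₀ n fun y => if y = x then 1 else 0 := by
  rw [occupancy, prob_eq_expect, stateExpect]
  congr! 3

theorem stateExpect_eq_sum (P : Dynamics X A) (π : Policy X A) (x₀ : X) (n : ℕ) (f : X → ℝ) :
    stateExpect P π x₀ n f = ∑ x, occupancy P π x₀ n x * f x := by
  classical
  simp only [occupancy_eq_stateExpect, stateExpect, ← expect_mul_const]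
  rw [← expect_sum]
  congr 1
  ext τ
  simp

theorem sum_occupancy (P : Dynamics X A) (π : Policy X A) (x₀ : X) (n : ℕ) :
    ∑ x, occupancy P π x₀ n x = 1 := by
  have h := stateExpect_eq_sum P π x₀ n fun _ => 1
  rw [stateExpect, expect_const] at h
  simpa using h.symm

theorem occupancy_le_one (P : Dynamics X A) (π : Policy X A) (x₀ : X) (n : ℕ) (x : X) :
    occupancy P π x₀ n x ≤ 1 := by
  rw [← sum_occupancy P π x₀ n]
  exact Finset.single_le_sum (fun y _ => occupancy_nonneg P π x₀ n y) (Finset.mem_univ x)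

theorem stateExpect_congr {P P' : Dynamics X A} {π π' : Policy X A} (x₀ : X) {n : ℕ}
    (hP : ∀ k < n, P k = P' k) (hπ : ∀ k < n, π k = π' k) (f : X → ℝ) :
    stateExpect P π x₀ n f = stateExpect P' π' x₀ n f := by
  induction n generalizing f with
  | zero => simp only [stateExpect_zero]
  | succ n ih =>
    have h : step P π n f = step P' π' n f := by
      unfold step
      rw [hP n n.lt_succ_self, hπ n n.lt_succ_self]
    rw [stateExpect_succ, stateExpect_succ, h]
    exact ih (fun k hk => hP k (hk.trans n.lt_succ_self))
      (fun k hk => hπ k (hk.trans n.lt_succ_self)) _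

theorem occupancy_congr {P P' : Dynamics X A} {π π' : Policy X A} (x₀ : X) {n : ℕ}
    (hP : ∀ k < n, P k = P' k) (hπ : ∀ k < n, π k = π' k) (x : X) :
    occupancy P π x₀ n x = occupancy P' π' x₀ n x := by
  classical
  simp only [occupancy_eq_stateExpect]
  exact stateExpect_congr x₀ hP hπ _

theorem value_eq_sum_stateExpect (H : ℕ) (P : Dynamics X A) (x₀ : X) (r : ℕ → X → A → ℝ)
    (π : Policy X A) :
    value H P x₀ r π =
      ∑ h ∈ Finset.range H, stateExpect P π x₀ h fun x => expect (π h x) (r h x) := by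
  have hv : ∀ n, value n P x₀ r π = expect (trajLaw P π x₀ n) fun τ =>
      ∑ h : Fin n, r h (τ.1 h.castSucc) (τ.2 h) := fun _ => rfl
  induction H with
  | zero => simp [hv, expect]
  | succ n ih =>
    rw [hv, expect_trajLaw_succ, Finset.sum_range_succ, ← ih, hv, stateExpect, ← expect_add]
    congr 1
    ext τ
    simp only [Fin.sum_univ_castSucc, Fin.snoc_castSucc, Fin.snoc_last, expect_const, expect_add,
      Fin.val_castSucc, Fin.val_last]

/-- The law of the transition at time `i` of an episode of horizon `H > i`. -/
theorem expect_trajLaw_transition (P : Dynamics X A) (π : Policy X A) (x₀ : X) {H : ℕ}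
    (i : Fin H) (g : X → A → X → ℝ) :
    (expect (trajLaw P π x₀ H) fun τ => g (τ.1 i.castSucc) (τ.2 i) (τ.1 i.succ)) =
      stateExpect P π x₀ i fun x => expect (π i x) fun a => expect (P i x a) (g x a) := by
  induction H with
  | zero => exact i.elim0
  | succ n ih =>
    rw [expect_trajLaw_succ]
    refine Fin.lastCases ?_ (fun i => ?_) i
    · simp only [Fin.snoc_castSucc, Fin.snoc_last, Fin.succ_last, Fin.val_last]
      rfl
    · simp only [Fin.snoc_castSucc, Fin.succ_castSucc, expect_const, Fin.val_castSucc]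
      exact ih i

end Trajectory

/-- Over weights in [0, 1] the sum is largest for the indicator of the set where `d` is positive;
applying this to `d` and `-d` gives both bounds. -/
theorem abs_sum_mul_le_of_abs_sum_le {X : Type*} [Fintype X] {d f : X → ℝ} {t : ℝ}
    (hd : ∀ B : Finset X, |∑ x ∈ B, d x| ≤ t) (hf : ∀ x, f x ∈ Set.Icc (0 : ℝ) 1) :
    |∑ x, d x * f x| ≤ t := by
  classical
  have key : ∀ e : X → ℝ, (∀ B : Finset X, ∑ x ∈ B, e x ≤ t) → ∑ x, e x * f x ≤ t := by
    intro e he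
    refine le_trans ?_ (he (Finset.univ.filter fun x => 0 < e x))
    rw [Finset.sum_filter]
    refine Finset.sum_le_sum fun x _ => ?_
    obtain ⟨h0, h1⟩ := hf x
    split_ifs with h
    · exact mul_le_of_le_one_right h.le h1
    · exact mul_nonpos_of_nonpos_of_nonneg (not_lt.1 h) h0
  rw [abs_le]
  constructor
  · have := key (fun x => -d x) fun B => by
      rw [Finset.sum_neg_distrib]
      exact (neg_le_abs _).trans (hd B)
    simp only [neg_mul, Finset.sum_neg_distrib] at this
    linarith
  · exact key d fun B => (le_abs_self _).trans (hd B)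

/-- The extension of a function on `S` by zero to the sink. -/
def extendZero {S : Type*} (f : S → ℝ) (x : Option S) : ℝ :=
  x.elim 0 f

/-! ### Comparison of the true and the learned dynamics. -/

section Simulation

variable {S A : Type*} [Fintype S] [Fintype A]

theorem step_mem_Icc (P : Dynamics S A) (π : Policy S A) (n : ℕ) {f : S → ℝ}
    (hf : ∀ x, f x ∈ Set.Icc (0 : ℝ) 1) (x : S) : step P π n f x ∈ Set.Icc (0 : ℝ) 1 :=
  ⟨expect_nonneg _ fun _ => expect_nonneg _ fun y => (hf y).1,
    expect_le_const _ fun _ => expect_le_const _ fun y => (hf y).2⟩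

variable [Nonempty A]

/-- At time `h`, the transitions of `Q` from the states `s ∈ T` are within `t s` of those of `P`
in total variation, and all other states move to the sink. -/
structure Approximates (P : Dynamics S A) (Q : Dynamics (Option S) A) (h : ℕ) (T : Finset S)
    (t : S → ℝ) : Prop where
  sink : ∀ a, Q h none a = PMF.pure none
  inactive : ∀ s ∉ T, ∀ a, Q h (some s) a = PMF.pure none
  active : ∀ s ∈ T, ∀ a, ∀ B : Finset S,
    |∑ x ∈ B, ((Q h (some s) a (some x)).toReal - (P h s a x).toReal)| ≤ t s

theorem expect_extendZero (p : PMF (Option S)) (f : S → ℝ) :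
    expect p (extendZero f) = ∑ x, (p (some x)).toReal * f x := by
  simp [expect, Fintype.sum_option, extendZero]

variable {P : Dynamics S A} {Q : Dynamics (Option S) A} {h : ℕ} {T : Finset S} {t : S → ℝ}

theorem Approximates.step_none (hQ : Approximates P Q h T t) (π : Policy S A) (f : S → ℝ) :
    step Q π.withSink h (extendZero f) none = 0 := by
  simp only [step, hQ.sink, expect_pure, expect_const]
  rfl

theorem Approximates.step_sub_step (hQ : Approximates P Q h T t) (π : Policy S A) {f : S → ℝ}
    (hf : ∀ x, f x ∈ Set.Icc (0 : ℝ) 1) (s : S) :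
    (s ∈ T → |step Q π.withSink h (extendZero f) (some s) - step P π h f s| ≤ t s) ∧
      (s ∉ T → step Q π.withSink h (extendZero f) (some s) = 0) := by
  refine ⟨fun hs => ?_, fun hs => ?_⟩
  · have hstep : step Q π.withSink h (extendZero f) (some s) - step P π h f s =
        expect (π h s) fun a =>
          ∑ x, ((Q h (some s) a (some x)).toReal - (P h s a x).toReal) * f x := by
      simp only [sub_mul, Finset.sum_sub_distrib, expect_sub, ← expect_extendZero]
      rfl
    have hle := fun a => abs_le.1 (abs_sum_mul_le_of_abs_sum_le (hQ.active s hs a) hf)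
    rw [hstep, abs_le]
    exact ⟨const_le_expect _ fun a => (hle a).1, expect_le_const _ fun a => (hle a).2⟩
  · simp only [step, hQ.inactive s hs, expect_pure, expect_const]
    rfl

/-- The simulation lemma: the error of the learned dynamics grows linearly with the time. -/
theorem stateExpect_sub_stateExpect_bounds [DecidableEq S] (π : Policy S A) (s₀ : S)
    (T : ℕ → Finset S) (t : ℕ → S → ℝ) {R U : ℝ} (n : ℕ)
    (hQ : ∀ k < n, Approximates P Q k (T k) (t k))
    (hR : ∀ k < n, ∑ s ∈ T k, occupancy Q π.withSink (some s₀) k (some s) * t k s ≤ R)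
    (hU : ∀ k < n, ∑ s ∈ (T k)ᶜ, occupancy Q π.withSink (some s₀) k (some s) ≤ U)
    {f : S → ℝ} (hf : ∀ x, f x ∈ Set.Icc (0 : ℝ) 1) :
    -(n * (R + U)) ≤ stateExpect Q π.withSink (some s₀) n (extendZero f) -
        stateExpect P π s₀ n f ∧
      stateExpect Q π.withSink (some s₀) n (extendZero f) - stateExpect P π s₀ n f ≤ n * R := by
  induction n generalizing f with
  | zero => simp [stateExpect_zero, extendZero]
  | succ n ih =>
    have hn := n.lt_succ_self
    have hg := step_mem_Icc P π n hf
    obtain ⟨ih₁, ih₂⟩ := ih (fun k hk => hQ k (hk.trans hn)) (fun k hk => hR k (hk.trans hn))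
      (fun k hk => hU k (hk.trans hn)) hg
    have hRn := hR n hn
    have hUn := hU n hn
    have hstep := (hQ n hn).step_sub_step π hf
    set q : S → ℝ := fun s => occupancy Q π.withSink (some s₀) n (some s) with hq
    have hq0 : ∀ s, 0 ≤ q s := fun s => occupancy_nonneg _ _ _ _ _
    -- The induction hypothesis, applied to `step P π n f`, handles the first `n` steps; this
    -- difference is the error made by the last transition alone.
    have hdiff : stateExpect Q π.withSink (some s₀) n (step Q π.withSink n (extendZero f)) -
        stateExpect Q π.withSink (some s₀) n (extendZero (step P π n f)) =
        ∑ s ∈ T n, q s * (step Q π.withSink n (extendZero f) (some s) - step P π n f s) +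
        ∑ s ∈ (T n)ᶜ, q s * (step Q π.withSink n (extendZero f) (some s) - step P π n f s) := by
      rw [Finset.sum_add_sum_compl, stateExpect_eq_sum, stateExpect_eq_sum, Fintype.sum_option,
        Fintype.sum_option, (hQ n hn).step_none]
      simp [extendZero, mul_sub, hq]
    have h1 : |∑ s ∈ T n, q s * (step Q π.withSink n (extendZero f) (some s) -
        step P π n f s)| ≤ R := by
      refine (Finset.abs_sum_le_sum_abs _ _).trans (le_trans ?_ hRn)
      refine Finset.sum_le_sum fun s hs => ?_
      rw [abs_mul, abs_of_nonneg (hq0 s)]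
      exact mul_le_mul_of_nonneg_left ((hstep s).1 hs) (hq0 s)
    have h2 : -U ≤ ∑ s ∈ (T n)ᶜ, q s * (step Q π.withSink n (extendZero f) (some s) -
        step P π n f s) := by
      rw [neg_le, ← Finset.sum_neg_distrib]
      refine le_trans (Finset.sum_le_sum fun s hs => ?_) hUn
      rw [(hstep s).2 (Finset.mem_compl.1 hs), zero_sub, mul_neg, neg_neg]
      exact mul_le_of_le_one_right (hq0 s) (hg s).2
    -- Mass lost to the sink can only lower the expectation of a nonnegative function, hence `U` is
    -- absent from the upper bound.
    have h3 : ∑ s ∈ (T n)ᶜ, q s * (step Q π.withSink n (extendZero f) (some s) -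
        step P π n f s) ≤ 0 := by
      refine Finset.sum_nonpos fun s hs => ?_
      rw [(hstep s).2 (Finset.mem_compl.1 hs), zero_sub, mul_neg]
      exact neg_nonpos.2 (mul_nonneg (hq0 s) (hg s).1)
    have h1' := abs_le.1 h1
    rw [stateExpect_succ, stateExpect_succ]
    push_cast
    constructor <;> linarith [h1'.1, h1'.2]

/-- Backward dynamic programming: the greedy action at the last step does at least as well as an
average over actions. This extends the planner's optimality from deterministic to stochastic
policies. -/
theorem exists_detPolicy_stateExpect_le (Q : Dynamics (Option S) A) (π : Policy S A)
    (x₀ : Option S) (n : ℕ) (f : Option S → ℝ) :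
    ∃ π' : DetPolicy S A,
      stateExpect Q π.withSink x₀ n f ≤ stateExpect Q π'.toPolicy.withSink x₀ n f := by
  induction n generalizing f with
  | zero => exact ⟨fun _ _ => Classical.arbitrary A, by simp only [stateExpect_zero, le_refl]⟩
  | succ n ih =>
    choose b hb using fun s : S => Finite.exists_max fun a => expect (Q n (some s) a) f
    obtain ⟨π', hπ'⟩ := ih (step Q π.withSink n f)
    refine ⟨Function.update π' n b, ?_⟩
    rw [stateExpect_succ, stateExpect_succ]
    have hcongr : ∀ g, stateExpect Q π'.toPolicy.withSink x₀ n g =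
        stateExpect Q (DetPolicy.toPolicy (Function.update π' n b)).withSink x₀ n g := by
      refine stateExpect_congr x₀ (fun _ _ => rfl) fun k hk => ?_
      ext x : 1
      cases x with
      | none => rfl
      | some s =>
        simp only [Policy.withSink, Option.elim, DetPolicy.toPolicy,
          Function.update_of_ne hk.ne]
    refine hπ'.trans ?_
    rw [hcongr]
    refine stateExpect_mono _ _ _ _ fun x => ?_
    cases x with
    | none => exact le_rfl
    | some s =>
      simp only [step, Policy.withSink, Option.elim, DetPolicy.toPolicy, Function.update_self,
        expect_pure]
      exact expect_le_const _ (hb s)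

end Simulation

/-! ### Active states, accuracy and its consequences for the values. -/

section Planning

variable {S A : Type*} [Nonempty A]

/-- The probability with which the planned policy reaches `s` at time `i` under the learned
dynamics. -/
noncomputable def plannedOccupancy (s₀ : S) (plan : Planner S A) (Q : Dynamics (Option S) A)
    (i : ℕ) (s : S) : ℝ :=
  occupancy Q (plan Q i s).toPolicy.withSink (some s₀) i (some s)

variable [Fintype S]

theorem plannedOccupancy_le_one [Fintype A] (s₀ : S) (plan : Planner S A) (Q : Dynamics (Option S) A)
    (i : ℕ) (s : S) : plannedOccupancy s₀ plan Q i s ≤ 1 :=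
  occupancy_le_one _ _ _ _ _

theorem mem_activeStates {s₀ : S} {β : ℝ} {plan : Planner S A} {Q : Dynamics (Option S) A}
    {i : ℕ} {s : S} :
    s ∈ activeStates s₀ β plan Q i ↔ β ≤ plannedOccupancy s₀ plan Q i s := by
  simp [activeStates, plannedOccupancy]

variable [Fintype A] {s₀ : S} {plan : Planner S A}

theorem occupancy_le_plannedOccupancy (hplan : IsOptimalPlanner s₀ plan)
    (Q : Dynamics (Option S) A) (π : Policy S A) (i : ℕ) (s : S) :
    occupancy Q π.withSink (some s₀) i (some s) ≤ plannedOccupancy s₀ plan Q i s := by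
  classical
  obtain ⟨π', hπ'⟩ := exists_detPolicy_stateExpect_le Q π (some s₀) i
    fun y => if y = some s then 1 else 0
  rw [← occupancy_eq_stateExpect, ← occupancy_eq_stateExpect] at hπ'
  exact hπ'.trans (hplan Q i s π')

/-- The planner may break ties differently for `Q` and `Q'`, but the maximum depends only on the
times before `i`. So the active sets survive the later filling of the place holders. -/
theorem plannedOccupancy_congr (hplan : IsOptimalPlanner s₀ plan)
    {Q Q' : Dynamics (Option S) A} {i : ℕ} (h : ∀ k < i, Q k = Q' k) (s : S) :
    plannedOccupancy s₀ plan Q i s = plannedOccupancy s₀ plan Q' i s := by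
  refine le_antisymm ?_ ?_
  · rw [plannedOccupancy, occupancy_congr _ h fun _ _ => rfl]
    exact hplan _ _ _ _
  · rw [plannedOccupancy, occupancy_congr _ (fun k hk => (h k hk).symm) fun _ _ => rfl]
    exact hplan _ _ _ _

theorem activeStates_congr (hplan : IsOptimalPlanner s₀ plan) (β : ℝ)
    {Q Q' : Dynamics (Option S) A} {i : ℕ} (h : ∀ k < i, Q k = Q' k) :
    activeStates s₀ β plan Q i = activeStates s₀ β plan Q' i := by
  ext s
  rw [mem_activeStates, mem_activeStates, plannedOccupancy_congr hplan h]

/-- The accuracy required of the transitions from a state that can be reached with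
probability `q`. -/
noncomputable def tolerance (S : Type*) [Fintype S] (H : ℕ) (β q : ℝ) : ℝ :=
  β / (4 * H) / √(Fintype.card S * q)

theorem tolerance_nonneg (S : Type*) [Fintype S] (H : ℕ) {β : ℝ} (hβ : 0 ≤ β) (q : ℝ) :
    0 ≤ tolerance S H β q := by
  rw [tolerance]
  positivity

/-- The dynamics learned at the times `h < i` are as accurate as required. -/
def Accurate (P : Dynamics S A) (s₀ : S) (H : ℕ) (β : ℝ) (plan : Planner S A) (i : ℕ)
    (Q : Dynamics (Option S) A) : Prop :=
  ∀ h < i, Approximates P Q h (activeStates s₀ β plan Q h)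
    fun s => tolerance S H β (plannedOccupancy s₀ plan Q h s)

variable {H : ℕ} {β : ℝ} {P : Dynamics S A} {Q : Dynamics (Option S) A} {i : ℕ}

/-- Since the occupancy is at most the planned one, its quotient by the root of the planned one is
at most its own root; by Cauchy-Schwarz these roots add up to at most √S. -/
theorem sum_occupancy_mul_tolerance_le (hplan : IsOptimalPlanner s₀ plan) (hβ : 0 < β)
    (π : Policy S A) (h : ℕ) :
    ∑ s ∈ activeStates s₀ β plan Q h, occupancy Q π.withSink (some s₀) h (some s) *
      tolerance S H β (plannedOccupancy s₀ plan Q h s) ≤ β / (4 * H) := by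
  set q : S → ℝ := fun s => occupancy Q π.withSink (some s₀) h (some s) with hq
  have hS : (0 : ℝ) < Fintype.card S := by exact_mod_cast Fintype.card_pos_iff.2 ⟨s₀⟩
  have hc : 0 ≤ β / (4 * H) := by positivity
  have hq0 : ∀ s, 0 ≤ q s := fun s => occupancy_nonneg _ _ _ _ _
  have hterm : ∀ s ∈ activeStates s₀ β plan Q h,
      q s * tolerance S H β (plannedOccupancy s₀ plan Q h s) ≤
        β / (4 * H) / √(Fintype.card S) * √(q s) := by
    intro s hs
    have hpos : 0 < plannedOccupancy s₀ plan Q h s := hβ.trans_le (mem_activeStates.1 hs)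
    have hle : √(q s) ≤ √(plannedOccupancy s₀ plan Q h s) :=
      Real.sqrt_le_sqrt (occupancy_le_plannedOccupancy hplan Q π h s)
    have hsq : q s ≤ √(q s) * √(plannedOccupancy s₀ plan Q h s) := by
      calc q s = √(q s) * √(q s) := (Real.mul_self_sqrt (hq0 s)).symm
        _ ≤ _ := mul_le_mul_of_nonneg_left hle (Real.sqrt_nonneg _)
    have hpos' := Real.sqrt_pos.2 hpos
    have hS' := Real.sqrt_pos.2 hS
    rw [tolerance, Real.sqrt_mul hS.le]
    calc q s * (β / (4 * H) / (√(Fintype.card S) * √(plannedOccupancy s₀ plan Q h s)))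
        = β / (4 * H) / √(Fintype.card S) * (q s / √(plannedOccupancy s₀ plan Q h s)) := by
          field_simp
      _ ≤ _ := mul_le_mul_of_nonneg_left ((div_le_iff₀ hpos').2 hsq) (by positivity)
  refine (Finset.sum_le_sum hterm).trans ?_
  rw [← Finset.mul_sum]
  have hsum : ∑ s ∈ activeStates s₀ β plan Q h, √(q s) ≤ √(Fintype.card S) := by
    refine (Finset.sum_le_univ_sum_of_nonneg fun s => Real.sqrt_nonneg _).trans ?_
    have hcs := Finset.sum_mul_sq_le_sq_mul_sq Finset.univ (fun s => √(q s)) fun _ => (1 : ℝ)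
    simp only [mul_one, one_pow, Finset.sum_const, Finset.card_univ, nsmul_eq_mul,
      Real.sq_sqrt (hq0 _)] at hcs
    have hone : ∑ s, q s ≤ 1 := by
      rw [← sum_occupancy Q π.withSink (some s₀) h, Fintype.sum_option]
      exact le_add_of_nonneg_left (occupancy_nonneg _ _ _ _ _)
    refine Real.le_sqrt_of_sq_le (hcs.trans ?_)
    exact mul_le_of_le_one_left hS.le hone
  calc β / (4 * H) / √(Fintype.card S) * ∑ s ∈ activeStates s₀ β plan Q h, √(q s)
      ≤ β / (4 * H) / √(Fintype.card S) * √(Fintype.card S) :=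
        mul_le_mul_of_nonneg_left hsum (by positivity)
    _ = β / (4 * H) := div_mul_cancel₀ _ (Real.sqrt_pos.2 hS).ne'

theorem sum_compl_activeStates_occupancy_le [DecidableEq S] (hplan : IsOptimalPlanner s₀ plan)
    (hβ : 0 < β) (π : Policy S A) (h : ℕ) :
    ∑ s ∈ (activeStates s₀ β plan Q h)ᶜ, occupancy Q π.withSink (some s₀) h (some s) ≤
      Fintype.card S * β := by
  have hle : ∀ s ∈ (activeStates s₀ β plan Q h)ᶜ,
      occupancy Q π.withSink (some s₀) h (some s) ≤ β := fun s hs =>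
    (occupancy_le_plannedOccupancy hplan Q π h s).trans
      (not_le.1 (mem_activeStates.not.1 (Finset.mem_compl.1 hs))).le
  refine (Finset.sum_le_card_nsmul _ _ _ hle).trans ?_
  rw [nsmul_eq_mul]
  exact mul_le_mul_of_nonneg_right (by exact_mod_cast Finset.card_le_univ _) hβ.le

theorem Accurate.stateExpect_bounds (hQ : Accurate P s₀ H β plan i Q)
    (hplan : IsOptimalPlanner s₀ plan) (hβ : 0 < β) (π : Policy S A) {f : S → ℝ}
    (hf : ∀ x, f x ∈ Set.Icc (0 : ℝ) 1) {n : ℕ} (hn : n ≤ i) :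
    -(n * (β / (4 * H) + Fintype.card S * β)) ≤
        stateExpect Q π.withSink (some s₀) n (extendZero f) - stateExpect P π s₀ n f ∧
      stateExpect Q π.withSink (some s₀) n (extendZero f) - stateExpect P π s₀ n f ≤
        n * (β / (4 * H)) := by
  classical
  exact stateExpect_sub_stateExpect_bounds π s₀ _ _ n (fun k hk => hQ k (hk.trans_le hn))
    (fun k _ => sum_occupancy_mul_tolerance_le hplan hβ π k)
    (fun k _ => sum_compl_activeStates_occupancy_le hplan hβ π k) hf

/-- Only the upper half of the simulation bound is used, which is free of the Sβ term; otherwise the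
loss would exceed the threshold β itself. -/
theorem Accurate.plannedOccupancy_le (hQ : Accurate P s₀ H β plan i Q) (hi : i < H)
    (hplan : IsOptimalPlanner s₀ plan) (hβ : 0 < β) (s : S) :
    plannedOccupancy s₀ plan Q i s - β / 4 ≤ occupancy P (plan Q i s).toPolicy s₀ i s := by
  classical
  have hH : (0 : ℝ) < H := by exact_mod_cast (Nat.zero_le i).trans_lt hi
  have h := (hQ.stateExpect_bounds hplan hβ (plan Q i s).toPolicy
    (f := fun y => if y = s then 1 else 0) (fun x => by split_ifs <;> simp) le_rfl).2
  have hf : extendZero (fun y => if y = s then (1 : ℝ) else 0) =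
      fun y => if y = some s then 1 else 0 := by
    ext y
    cases y <;> simp [extendZero]
  rw [hf, ← occupancy_eq_stateExpect, ← occupancy_eq_stateExpect] at h
  have hiH : (i : ℝ) * (β / (4 * H)) ≤ β / 4 := by
    have : (i : ℝ) ≤ H := by exact_mod_cast hi.le
    calc (i : ℝ) * (β / (4 * H)) ≤ H * (β / (4 * H)) :=
          mul_le_mul_of_nonneg_right this (by positivity)
      _ = β / 4 := by field_simp
  rw [plannedOccupancy]
  linarith

theorem Accurate.valuesClose (hQ : Accurate P s₀ H β plan H Q) (hH : 0 < H)
    (hplan : IsOptimalPlanner s₀ plan) (hβ : 0 < β) :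
    ValuesClose H P s₀ ((H : ℝ) ^ 2 * (Fintype.card S * β)) Q := by
  intro π r hr
  have hH' : (1 : ℝ) ≤ H := by exact_mod_cast hH
  have hS : (1 : ℝ) ≤ Fintype.card S := by exact_mod_cast Fintype.card_pos_iff.2 ⟨s₀⟩
  set c := β / (4 * H) + Fintype.card S * β with hc
  have hext : ∀ h, (fun x => expect (π.withSink h x) (rewardWithSink r h x)) =
      extendZero fun s => expect (π h s) (r h s) := by
    intro h
    ext x
    cases x with
    | none => exact expect_const _ 0
    | some s => rfl
  rw [value_eq_sum_stateExpect, value_eq_sum_stateExpect, ← Finset.sum_sub_distrib]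
  refine (Finset.abs_sum_le_sum_abs _ _).trans ?_
  have hterm : ∀ h ∈ Finset.range H, |(stateExpect P π s₀ h fun x => expect (π h x) (r h x)) -
      stateExpect Q π.withSink (some s₀) h fun x =>
        expect (π.withSink h x) (rewardWithSink r h x)| ≤ h * c := by
    intro h hh
    have hh' := Finset.mem_range.1 hh
    have hb := hQ.stateExpect_bounds hplan hβ π (f := fun s => expect (π h s) (r h s))
      (fun s => ⟨expect_nonneg _ fun a => (hr h hh' s a).1,
        expect_le_const _ fun a => (hr h hh' s a).2⟩) hh'.le
    have hR : (h : ℝ) * (β / (4 * H)) ≤ h * c := by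
      rw [hc]
      exact mul_le_mul_of_nonneg_left (le_add_of_nonneg_right (by positivity)) (by positivity)
    rw [hext, abs_le]
    constructor <;> linarith [hb.1, hb.2]
  refine (Finset.sum_le_sum hterm).trans ?_
  rw [← Finset.sum_mul]
  have hsum : ∑ h ∈ Finset.range H, (h : ℝ) ≤ (H : ℝ) ^ 2 / 2 := by
    have := Finset.sum_range_id_mul_two H
    have h2 := congrArg (Nat.cast : ℕ → ℝ) this
    rw [Nat.cast_mul, Nat.cast_mul, Nat.cast_sub hH, Nat.cast_sum] at h2
    push_cast at h2
    nlinarith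
  -- The factor 2 here cancels the 1/2 of the sum of the times.
  have hc2 : c ≤ 2 * (Fintype.card S * β) := by
    have h1 : β / (4 * H) ≤ β := div_le_self hβ.le (by linarith)
    have h2 : β ≤ Fintype.card S * β := le_mul_of_one_le_left hβ.le hS
    linarith
  have hc0 : 0 ≤ c := by positivity
  calc (∑ h ∈ Finset.range H, (h : ℝ)) * c ≤ (H : ℝ) ^ 2 / 2 * (2 * (Fintype.card S * β)) :=
        mul_le_mul hsum hc2 hc0 (by positivity)
    _ = _ := by ring

end Planning

/-! ### Exponential moments and independence. -/

section Probability

variable {X : Type*} [Fintype X]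

/-- Hoeffding's lemma for a variable with values in [0, 1]. -/
theorem expect_exp_centered_indicator_le (p : PMF X) [DecidableEq X] (B : Finset X) (l : ℝ) :
    (expect p fun x => Real.exp (l * ((if x ∈ B then 1 else 0) - ∑ y ∈ B, (p y).toReal))) ≤
      Real.exp (l ^ 2 / 8) := by
  let _ : MeasurableSpace X := ⊤
  have hmem : ∀ᵐ x ∂p.toMeasure, (if x ∈ B then (1 : ℝ) else 0) ∈ Set.Icc (0 : ℝ) 1 :=
    Filter.Eventually.of_forall fun x => by split_ifs <;> simp
  have h := (ProbabilityTheory.hasSubgaussianMGF_of_mem_Icc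
    (Measurable.of_discrete.aemeasurable) hmem).mgf_le l
  have hmean : ∫ x, (if x ∈ B then (1 : ℝ) else 0) ∂p.toMeasure = ∑ y ∈ B, (p y).toReal := by
    simp [PMF.integral_eq_sum]
  rw [hmean, ProbabilityTheory.mgf, PMF.integral_eq_sum] at h
  simp only [smul_eq_mul] at h
  refine h.trans_eq ?_
  congr 1
  simp
  ring

theorem expect_indep {m : ℕ} (p : Fin m → PMF X) (g : Fin m → X → ℝ) :
    (expect (indep p) fun f => ∏ j, g j (f j)) = ∏ j, expect (p j) (g j) := by
  classical
  simp only [expect, indep, PMF.ofFintype_apply, ENNReal.toReal_prod, ← Finset.prod_mul_distrib]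
  rw [Finset.prod_univ_sum, Fintype.piFinset_univ]

/-- The exponential Markov inequality for a sum of independent terms. -/
theorem prob_indep_sum_nonneg_le {m : ℕ} (p : Fin m → PMF X) (Y : X → ℝ) {l : ℝ} (hl : 0 ≤ l) :
    prob (indep p) (fun f => 0 ≤ ∑ j, Y (f j)) ≤
      ∏ j, expect (p j) fun x => Real.exp (l * Y x) := by
  classical
  rw [prob_eq_expect, ← expect_indep]
  refine expect_mono _ fun f => ?_
  rw [← Real.exp_sum, ← Finset.mul_sum]
  split_ifs with h
  · exact Real.one_le_exp (mul_nonneg hl h)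
  · exact (Real.exp_pos _).le

theorem prob_le_sum {ι : Type*} [Fintype ι] (p : PMF X) {E : X → Prop} {F : ι → X → Prop}
    (h : ∀ x, E x → ∃ k, F k x) : prob p E ≤ ∑ k, prob p (F k) := by
  classical
  simp only [prob_eq_expect]
  rw [← expect_sum]
  refine expect_mono _ fun x => ?_
  have h0 : ∀ k ∈ Finset.univ, (0 : ℝ) ≤ if F k x then 1 else 0 := fun k _ => by
    split_ifs <;> simp
  split_ifs with hx
  · obtain ⟨k, hk⟩ := h x hx
    refine le_trans ?_ (Finset.single_le_sum h0 (Finset.mem_univ k))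
    simp [hk]
  · exact Finset.sum_nonneg h0

end Probability

/-! ### Concentration of the empirical transitions. -/

section Concentration

variable {S A : Type*} [Fintype S] [DecidableEq S] [DecidableEq A]

/-- The contribution of one trajectory to the excess of `N_i(s, a, B)` over
`(P_i(B ∣ s, a) + t) N_i(s, a)`. -/
noncomputable def excess (P : Dynamics S A) {H : ℕ} (i : Fin H) (s : S) (a : A) (B : Finset S)
    (t : ℝ) (τ : Trajectory S A H) : ℝ :=
  if τ.1 i.castSucc = s ∧ τ.2 i = a then
    (if τ.1 i.succ ∈ B then 1 else 0) - ∑ x ∈ B, (P i s a x).toReal - t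
  else 0

variable (P : Dynamics S A) {H : ℕ} (i : Fin H) (s : S) (a : A) (B : Finset S)

theorem sum_excess {m : ℕ} (t : ℝ) (D : Fin m → Trajectory S A H) :
    ∑ j, excess P i s a B t (D j) = ∑ x ∈ B, (count D i s a x : ℝ) -
      (∑ x ∈ B, (P i s a x).toReal + t) * ∑ x, (count D i s a x : ℝ) := by
  have hcount : ∀ B : Finset S, ∑ x ∈ B, (count D i s a x : ℝ) =
      ∑ j, if (D j).1 i.castSucc = s ∧ (D j).2 i = a then
        (if (D j).1 i.succ ∈ B then (1 : ℝ) else 0) else 0 := by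
    intro B
    simp only [count, Finset.card_filter, Nat.cast_sum]
    rw [Finset.sum_comm]
    refine Finset.sum_congr rfl fun j _ => ?_
    by_cases h1 : (D j).1 i.castSucc = s <;> by_cases h2 : (D j).2 i = a <;> simp [h1, h2]
  rw [hcount, hcount, Finset.mul_sum, ← Finset.sum_sub_distrib]
  refine Finset.sum_congr rfl fun j _ => ?_
  simp only [excess, Finset.mem_univ, if_true]
  split_ifs <;> ring

theorem empirical_active {m : ℕ} (D : Fin m → Trajectory S A H) {T : Finset S} (hs : s ∈ T)
    (hN : ∑ x, count D i s a x ≠ 0) (x : S) :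
    (empirical T D i (some s) a (some x)).toReal =
      count D i s a x / ∑ y, (count D i s a y : ℝ) := by
  have hne : s ∈ T ∧ ∑ x, count D i s a x ≠ 0 := ⟨hs, hN⟩
  rw [empirical, dif_pos hne, PMF.map_apply, tsum_fintype]
  simp only [Option.some.injEq, Finset.sum_ite_eq, Finset.mem_univ, if_true, PMF.normalize_apply,
    tsum_fintype]
  rw [ENNReal.toReal_mul, ENNReal.toReal_inv, ← Nat.cast_sum, ENNReal.toReal_natCast,
    ENNReal.toReal_natCast, Nat.cast_sum, div_eq_mul_inv]

variable {P i s a B} in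
-- One-sided bounds for all sets suffice: the lower bound for `B` is the upper bound for its
-- complement.
theorem empirical_sub_le {m : ℕ} {t : ℝ} {D : Fin m → Trajectory S A H} {T : Finset S}
    (hs : s ∈ T) (hD : ∀ B, ∑ j, excess P i s a B t (D j) < 0) (B : Finset S) :
    |∑ x ∈ B, ((empirical T D i (some s) a (some x)).toReal - (P i s a x).toReal)| ≤ t := by
  simp only [sum_excess] at hD
  have hN : ∑ x, count D i s a x ≠ 0 := by
    intro h0
    have h0' : ∑ x, (count D i s a x : ℝ) = 0 := by exact_mod_cast h0
    -- For the empty set the total excess is -t times the number of visits, so its strict negativity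
    -- rules out an empty sample.
    have := hD ∅
    simp [h0'] at this
  have hNpos : (0 : ℝ) < ∑ x, (count D i s a x : ℝ) := by
    exact_mod_cast Nat.pos_of_ne_zero hN
  simp only [empirical_active i s a D hs hN]
  have hle : ∀ B : Finset S, ∑ x ∈ B, (count D i s a x / ∑ y, (count D i s a y : ℝ) -
      (P i s a x).toReal) ≤ t := by
    intro B
    rw [Finset.sum_sub_distrib, ← Finset.sum_div, sub_le_iff_le_add', div_le_iff₀ hNpos]
    linarith [hD B]
  have htotal : ∑ x ∈ B, (count D i s a x / ∑ y, (count D i s a y : ℝ) - (P i s a x).toReal) +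
      ∑ x ∈ Bᶜ, (count D i s a x / ∑ y, (count D i s a y : ℝ) - (P i s a x).toReal) = 0 := by
    rw [Finset.sum_add_sum_compl, Finset.sum_sub_distrib, ← Finset.sum_div,
      div_self hNpos.ne', sum_toReal_eq_one, sub_self]
  rw [abs_le]
  exact ⟨by linarith [hle Bᶜ], hle B⟩

variable [Fintype A]

/-- Given a visit, Hoeffding's lemma at the optimal parameter 4t gives exp((4t)²/8 - 4t²) =
exp(-2t²) = 1 - κ; without a visit the factor is 1. With visit probability w the mean is at most 1 -
κw ≤ exp(-κw). -/
theorem expect_exp_excess_le (π : Policy S A) (s₀ : S) (t : ℝ) :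
    (expect (trajLaw P π s₀ H) fun τ => Real.exp (4 * t * excess P i s a B t τ)) ≤
      Real.exp (-((1 - Real.exp (-(2 * t ^ 2))) * stateExpect P π s₀ i fun x =>
        expect (π i x) fun a' => if x = s ∧ a' = a then 1 else 0)) := by
  set κ := 1 - Real.exp (-(2 * t ^ 2)) with hκ
  have htrans := expect_trajLaw_transition P π s₀ i fun x a' x' =>
    Real.exp (4 * t * if x = s ∧ a' = a then
      (if x' ∈ B then 1 else 0) - ∑ x ∈ B, (P i s a x).toReal - t else 0)
  simp only [excess]
  rw [htrans]
  have hinner : ∀ x a', (expect (P i x a') fun x' => Real.exp (4 * t * if x = s ∧ a' = a then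
      (if x' ∈ B then 1 else 0) - ∑ x ∈ B, (P i s a x).toReal - t else 0)) ≤
      1 - (if x = s ∧ a' = a then 1 else 0) * κ := by
    intro x a'
    split_ifs with h
    · obtain ⟨rfl, rfl⟩ := h
      have he := expect_exp_centered_indicator_le (P i x a') B (4 * t)
      have hfactor : ∀ x' : S, Real.exp (4 * t * ((if x' ∈ B then 1 else 0) -
          ∑ y ∈ B, (P i x a' y).toReal - t)) =
          Real.exp (4 * t * ((if x' ∈ B then 1 else 0) - ∑ y ∈ B, (P i x a' y).toReal)) *
            Real.exp (-(4 * t ^ 2)) := fun x' => by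
        rw [← Real.exp_add]
        ring_nf
      simp only [hfactor]
      rw [expect_mul_const]
      refine (mul_le_mul_of_nonneg_right he (Real.exp_pos _).le).trans_eq ?_
      rw [← Real.exp_add, hκ, one_mul, sub_sub_cancel]
      ring_nf
    · simp [expect_const]
  have hle : (stateExpect P π s₀ i fun x => expect (π i x) fun a' =>
      expect (P i x a') fun x' => Real.exp (4 * t * if x = s ∧ a' = a then
      (if x' ∈ B then 1 else 0) - ∑ x ∈ B, (P i s a x).toReal - t else 0)) ≤
      stateExpect P π s₀ i fun x => expect (π i x) fun a' =>
        1 - (if x = s ∧ a' = a then 1 else 0) * κ :=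
    stateExpect_mono _ _ _ _ fun x => expect_mono _ fun a' => hinner x a'
  refine hle.trans ?_
  simp only [expect_sub, expect_const, expect_mul_const, stateExpect]
  rw [mul_comm]
  exact Real.one_sub_le_exp_neg _

/-- Forcing the action at time `i` leaves the law of the state at time `i` unchanged. -/
theorem reach_forceAction [Nonempty A] (π : DetPolicy S A) (s₀ : S) :
    (stateExpect P (forceAction π i s a).toPolicy s₀ i fun x =>
      expect ((forceAction π i s a).toPolicy i x) fun a' =>
        if x = s ∧ a' = a then (1 : ℝ) else 0) = occupancy P π.toPolicy s₀ i s := by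
  rw [occupancy_eq_stateExpect]
  have hf : (fun x => expect ((forceAction π i s a).toPolicy i x) fun a' =>
      if x = s ∧ a' = a then (1 : ℝ) else 0) = fun x => if x = s then 1 else 0 := by
    ext x
    rw [DetPolicy.toPolicy, expect_pure]
    by_cases hx : x = s <;> simp [forceAction, hx]
  rw [hf]
  refine stateExpect_congr s₀ (fun _ _ => rfl) (fun k hk => ?_) _
  ext x : 1
  simp [DetPolicy.toPolicy, forceAction, hk.ne]

end Concentration

/-- The number of agents per group suffices for the required accuracy. -/
theorem sample_size_bound {S A H ε l m G q₀ q β : ℝ} (hS : 1 ≤ S) (hA : 1 ≤ A) (hH : 1 ≤ H)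
    (hε : 0 < ε) (hl : 1 ≤ l) (hβ : β = ε / (2 * H ^ 2 * S)) (hq₀ : β ≤ q₀) (hq₀' : q₀ ≤ 1)
    (hm : 89 * (S ^ 5 * H ^ 6 * A * l / ε ^ 2) ≤ m) (hG : m / (S * A) - 1 ≤ G)
    (hq : q₀ - β / 4 ≤ q) :
    l ≤ (1 - Real.exp (-(2 * (β / (4 * H) / √(S * q₀)) ^ 2))) * (G * q) := by
  have hβ0 : 0 < β := by rw [hβ]; positivity
  have hq₀0 : 0 < q₀ := hβ0.trans_le hq₀
  have hβ1 : β ≤ 1 := hq₀.trans hq₀'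
  have hεβ : ε = 2 * H ^ 2 * S * β := by rw [hβ]; field_simp
  set x := β ^ 2 / (8 * H ^ 2 * S * q₀) with hx
  have hx0 : 0 < x := by positivity
  have hxt : 2 * (β / (4 * H) / √(S * q₀)) ^ 2 = x := by
    rw [div_pow, Real.sq_sqrt (by positivity), hx]
    field_simp
    norm_num
  have hx1 : x ≤ 1 / 8 := by
    rw [hx, div_le_div_iff₀ (by positivity) (by norm_num)]
    have h1 : β ^ 2 ≤ q₀ := by nlinarith
    have h2 : 1 ≤ H ^ 2 * S := one_le_mul_of_one_le_of_one_le (one_le_pow₀ hH) hS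
    nlinarith
  -- The constant 8/9 is 1/(1 + x) at the largest value x = 1/8.
  have hκ : 8 / 9 * x ≤ 1 - Real.exp (-x) := by
    have h1 : Real.exp (-x) ≤ 1 / (1 + x) := by
      rw [Real.exp_neg, ← one_div]
      exact one_div_le_one_div_of_le (by positivity) (by linarith [Real.add_one_le_exp x])
    have h2 : 1 / (1 + x) ≤ 1 - 8 / 9 * x := by
      rw [div_le_iff₀ (by positivity)]
      nlinarith
    linarith
  -- Substituting ε = 2H²Sβ turns the sample size into a multiple of 1/β²; the -1 pays for rounding
  -- the group size.
  have hGlow : 89 / 4 * (S ^ 2 * H ^ 2 * l / β ^ 2) - 1 ≤ G := by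
    refine le_trans (sub_le_sub_right ?_ 1) hG
    rw [le_div_iff₀ (by positivity)]
    refine le_trans (le_of_eq ?_) hm
    rw [hεβ]
    field_simp
    ring
  have hGpos : 0 ≤ G := by
    refine le_trans ?_ hGlow
    have h1 : 1 ≤ S ^ 2 * H ^ 2 * l / β ^ 2 := by
      rw [le_div_iff₀ (by positivity), one_mul]
      exact (pow_le_one₀ hβ0.le hβ1).trans (one_le_mul_of_one_le_of_one_le
        (one_le_mul_of_one_le_of_one_le (one_le_pow₀ hS) (one_le_pow₀ hH)) hl)
    linarith
  have hq' : 3 / 4 * q₀ ≤ q := by linarith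
  rw [hxt]
  -- The 12 comes from 8/9 · 3/4 · 1/8 = 1/12; q₀ cancels between the tolerance and the number of
  -- visits.
  calc l ≤ β ^ 2 / (12 * H ^ 2 * S) * (89 / 4 * (S ^ 2 * H ^ 2 * l / β ^ 2) - 1) := by
        have h1 : β ^ 2 / (12 * H ^ 2 * S) * (89 / 4 * (S ^ 2 * H ^ 2 * l / β ^ 2) - 1) =
            89 / 48 * (S * l) - β ^ 2 / (12 * H ^ 2 * S) := by
          field_simp
          ring
        have h2 : β ^ 2 / (12 * H ^ 2 * S) ≤ 1 / 12 := by
          rw [div_le_div_iff₀ (by positivity) (by norm_num)]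
          have h3 : 1 ≤ H ^ 2 * S := one_le_mul_of_one_le_of_one_le (one_le_pow₀ hH) hS
          have h4 : β ^ 2 ≤ 1 := pow_le_one₀ hβ0.le hβ1
          nlinarith
        have h5 : l ≤ S * l := le_mul_of_one_le_left (by linarith) hS
        rw [h1]
        linarith
    _ ≤ β ^ 2 / (12 * H ^ 2 * S) * G := mul_le_mul_of_nonneg_left hGlow (by positivity)
    _ = 8 / 9 * x * (G * (3 / 4 * q₀)) := by
        rw [hx]
        field_simp
        ring
    _ ≤ _ := mul_le_mul hκ (mul_le_mul_of_nonneg_left hq' hGpos) (by positivity)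
        (le_trans (by positivity) hκ)

/-! ### Union bounds for laws on the infinite type of dynamics. -/

theorem toOuterMeasure_univ {X : Type*} (p : PMF X) : p.toOuterMeasure Set.univ = 1 :=
  (p.toOuterMeasure_apply_eq_one_iff _).2 (Set.subset_univ _)

theorem toOuterMeasure_le_one {X : Type*} (p : PMF X) (E : Set X) : p.toOuterMeasure E ≤ 1 :=
  (p.toOuterMeasure.mono (Set.subset_univ E)).trans_eq (toOuterMeasure_univ p)

theorem toOuterMeasure_eq_ofReal_prob {X : Type*} (p : PMF X) (E : X → Prop) :
    p.toOuterMeasure {x | E x} = ENNReal.ofReal (prob p E) :=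
  (ENNReal.ofReal_toReal ((toOuterMeasure_le_one p _).trans_lt ENNReal.one_lt_top).ne).symm

theorem one_sub_le_prob {X : Type*} (p : PMF X) {E F : X → Prop} {η : ℝ} (hη : 0 ≤ η)
    (h : p.toOuterMeasure {x | ¬E x} ≤ ENNReal.ofReal η) (hEF : ∀ x, E x → F x) :
    1 - η ≤ prob p F := by
  have hcover : (1 : ℝ≥0∞) ≤ p.toOuterMeasure {x | F x} + p.toOuterMeasure {x | ¬E x} := by
    rw [← toOuterMeasure_univ p]
    refine (p.toOuterMeasure.mono fun x _ => ?_).trans (MeasureTheory.measure_union_le _ _)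
    by_cases hx : E x
    · exact Or.inl (hEF x hx)
    · exact Or.inr hx
  rw [toOuterMeasure_eq_ofReal_prob] at hcover
  have h1 := hcover.trans (add_le_add_right h _)
  rw [← ENNReal.ofReal_add (q := η) (p := prob p F) ENNReal.toReal_nonneg hη, ENNReal.one_le_ofReal] at h1
  linarith

/-- A union bound over two successive random steps. -/
theorem toOuterMeasure_bind_le {X Y : Type*} (p : PMF X) (f : X → PMF Y) {E : Set X} {F : Set Y}
    {c : ℝ≥0∞} (h : ∀ x ∉ E, (f x).toOuterMeasure F ≤ c) :
    (p.bind f).toOuterMeasure F ≤ p.toOuterMeasure E + c := by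
  rw [PMF.toOuterMeasure_bind_apply, PMF.toOuterMeasure_apply]
  calc ∑' x, p x * (f x).toOuterMeasure F ≤ ∑' x, (E.indicator p x + p x * c) := by
        refine ENNReal.tsum_le_tsum fun x => ?_
        by_cases hx : x ∈ E
        · rw [Set.indicator_of_mem hx]
          refine le_trans ?_ le_self_add
          exact (mul_le_mul_right (toOuterMeasure_le_one _ _) _).trans_eq (mul_one _)
        · rw [Set.indicator_of_notMem hx, zero_add]
          exact mul_le_mul_right (h x hx) _
    _ = _ := by rw [ENNReal.tsum_add, ENNReal.tsum_mul_right, p.tsum_coe, one_mul]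

/-! ### Induction over the phases. -/

section Run

variable {S A : Type*} [Fintype S] [Fintype A] [Nonempty A] {s₀ : S} {H : ℕ} {P : Dynamics S A}
  {β : ℝ} {m : ℕ} {plan : Planner S A} {grp : Grouping S A m} {i : ℕ}
  {Q : Dynamics (Option S) A}

theorem Accurate.update (hQ : Accurate P s₀ H β plan i Q) (hplan : IsOptimalPlanner s₀ plan)
    {q : Option S → A → PMF (Option S)}
    (hq : Approximates P (Function.update Q i q) i (activeStates s₀ β plan Q i)
      fun s => tolerance S H β (plannedOccupancy s₀ plan Q i s)) :
    Accurate P s₀ H β plan (i + 1) (Function.update Q i q) := by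
  intro h hh
  have hagree : ∀ k < h, Function.update Q i q k = Q k := fun k hk =>
    Function.update_of_ne (hk.trans_le (Nat.lt_succ_iff.1 hh)).ne _ _
  simp only [activeStates_congr hplan β hagree, plannedOccupancy_congr hplan hagree]
  rcases (Nat.lt_succ_iff.1 hh).lt_or_eq with hlt | rfl
  · have hh' : Function.update Q i q h = Q h := Function.update_of_ne hlt.ne _ _
    obtain ⟨h1, h2, h3⟩ := hQ h hlt
    exact ⟨fun a => by rw [hh', h1], fun s hs a => by rw [hh', h2 s hs],
      fun s hs a B => by rw [hh']; exact h3 s hs a B⟩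
  · exact hq

variable [DecidableEq S] [DecidableEq A]

/-- Every agent contributes a factor exp(-κw) with w its probability of visiting the pair. Agents of
other groups have w ≥ 0 and only help, so keeping those of the group of `(s, a)` is enough. -/
theorem prob_excess_nonneg_le (hi : i < H) {s : S} {a : A} {t : ℝ} (ht : 0 ≤ t) (B : Finset S)
    {G : ℕ} (hG : G ≤ (Finset.univ.filter fun j =>
      grp i (activeStates s₀ β plan Q i) j = (s, a)).card) :
    prob (phaseData P s₀ H β plan grp Q i)
      (fun D => 0 ≤ ∑ j, excess P ⟨i, hi⟩ s a B t (D j)) ≤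
      Real.exp (-((1 - Real.exp (-(2 * t ^ 2))) *
        (G * occupancy P (plan Q i s).toPolicy s₀ i s))) := by
  set κ := 1 - Real.exp (-(2 * t ^ 2)) with hκ
  have hκ0 : 0 ≤ κ := sub_nonneg.2 (Real.exp_le_one_iff.2 (by nlinarith [sq_nonneg t]))
  set g := grp i (activeStates s₀ β plan Q i) with hg
  set w : Fin m → ℝ := fun j =>
    stateExpect P (forceAction (plan Q i (g j).1) i (g j).1 (g j).2).toPolicy s₀ i fun x =>
      expect ((forceAction (plan Q i (g j).1) i (g j).1 (g j).2).toPolicy i x) fun a' =>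
        if x = s ∧ a' = a then 1 else 0 with hw
  have hw0 : ∀ j, 0 ≤ w j := fun j => expect_nonneg _ fun _ => expect_nonneg _ fun _ => by
    split_ifs <;> simp
  have hwgroup : ∀ j ∈ Finset.univ.filter fun j => g j = (s, a),
      w j = occupancy P (plan Q i s).toPolicy s₀ i s := by
    intro j hj
    simp only [hw, (Finset.mem_filter.1 hj).2]
    exact reach_forceAction P ⟨i, hi⟩ s a (plan Q i s) s₀
  have hsum : G * occupancy P (plan Q i s).toPolicy s₀ i s ≤ ∑ j, w j := by
    refine le_trans ?_ (Finset.sum_le_univ_sum_of_nonneg hw0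
      (s := Finset.univ.filter fun j => g j = (s, a)))
    rw [Finset.sum_congr rfl hwgroup, Finset.sum_const, nsmul_eq_mul]
    exact mul_le_mul_of_nonneg_right (by exact_mod_cast hG) (occupancy_nonneg _ _ _ _ _)
  refine (prob_indep_sum_nonneg_le _ (excess P ⟨i, hi⟩ s a B t) (l := 4 * t)
    (by positivity)).trans ?_
  calc _ ≤ ∏ j, Real.exp (-(κ * w j)) :=
        Finset.prod_le_prod (fun j _ => expect_nonneg _ fun _ => (Real.exp_pos _).le)
          fun j _ => expect_exp_excess_le P ⟨i, hi⟩ s a B _ s₀ t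
    _ = Real.exp (-(κ * ∑ j, w j)) := by
        rw [← Real.exp_sum, Finset.sum_neg_distrib, ← Finset.mul_sum]
    _ ≤ _ := Real.exp_le_exp.2 (neg_le_neg (mul_le_mul_of_nonneg_left hsum hκ0))

theorem Accurate.prob_phaseData_not_approximates_le (hQ : Accurate P s₀ H β plan i Q)
    (hi : i < H) (hplan : IsOptimalPlanner s₀ plan) (hgrp : IsEqualGrouping grp) {ε l : ℝ}
    (hε : 0 < ε) (hl : 1 ≤ l) (hβ : β = ε / (2 * (H : ℝ) ^ 2 * (Fintype.card S : ℝ)))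
    (hm : 89 * ((Fintype.card S : ℝ) ^ 5 * (H : ℝ) ^ 6 * (Fintype.card A : ℝ) * l / ε ^ 2) ≤
      (m : ℝ)) :
    prob (phaseData P s₀ H β plan grp Q i) (fun D => ¬Approximates P
        (Function.update Q i (empirical (activeStates s₀ β plan Q i) D ⟨i, hi⟩)) i
        (activeStates s₀ β plan Q i)
        fun s => tolerance S H β (plannedOccupancy s₀ plan Q i s)) ≤
      Fintype.card S * Fintype.card A * 2 ^ Fintype.card S * Real.exp (-l) := by
  have hS : (1 : ℝ) ≤ Fintype.card S := by exact_mod_cast Fintype.card_pos_iff.2 ⟨s₀⟩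
  have hA : (1 : ℝ) ≤ Fintype.card A := by exact_mod_cast Fintype.card_pos (α := A)
  have hH : (1 : ℝ) ≤ H := by exact_mod_cast (Nat.zero_le i).trans_lt hi
  have hβ0 : 0 < β := by rw [hβ]; positivity
  set T := activeStates s₀ β plan Q i with hT
  set t : S → ℝ := fun s => tolerance S H β (plannedOccupancy s₀ plan Q i s) with ht
  refine (prob_le_sum (ι := S × A × Finset S) _ (F := fun k D =>
    k.1 ∈ T ∧ 0 ≤ ∑ j, excess P ⟨i, hi⟩ k.1 k.2.1 k.2.2 (t k.1) (D j)) ?_).trans ?_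
  · intro D hD
    by_contra hcon
    push Not at hcon
    refine hD ⟨fun a => ?_, fun s hs a => ?_, fun s hs a B => ?_⟩
    · rw [Function.update_self, empirical]
    · rw [Function.update_self, empirical, dif_neg fun h => hs h.1]
    · rw [Function.update_self]
      exact empirical_sub_le hs (fun B' => hcon (s, a, B') hs) B
  · refine (Finset.sum_le_card_nsmul _ _ (Real.exp (-l)) fun k _ => ?_).trans_eq ?_
    · obtain ⟨s, a, B⟩ := k
      by_cases hs : s ∈ T
      · have hq := mem_activeStates.1 hs
        have hTpos : 0 < T.card := Finset.card_pos.2 ⟨s, hs⟩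
        -- There are at most S active states, so the group size is bounded below independently of
        -- the active set.
        have hgroup : m / (Fintype.card S * Fintype.card A) ≤
            (Finset.univ.filter fun j => grp i T j = (s, a)).card := by
          refine le_trans (Nat.div_le_div_left ?_ (Nat.mul_pos hTpos Fintype.card_pos))
            ((hgrp i T ⟨s, hs⟩).2 s hs a)
          exact Nat.mul_le_mul_right _ (Finset.card_le_univ T)
        have hfloor : (m : ℝ) / (Fintype.card S * Fintype.card A) - 1 ≤
            ((m / (Fintype.card S * Fintype.card A) : ℕ) : ℝ) := by
          have h := Nat.lt_floor_add_one ((m : ℝ) / ((Fintype.card S * Fintype.card A : ℕ) : ℝ))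
          rw [Nat.floor_div_eq_div] at h
          push_cast at h
          linarith
        simp only [hs, true_and]
        refine (prob_excess_nonneg_le hi (tolerance_nonneg S H hβ0.le _) B hgroup).trans
          (Real.exp_le_exp.2 (neg_le_neg ?_))
        exact sample_size_bound hS hA hH hε hl hβ hq (plannedOccupancy_le_one _ _ _ _ _) hm
          hfloor (hQ.plannedOccupancy_le hi hplan hβ0 s)
      · simp only [hs, false_and]
        simp [prob, (Real.exp_pos _).le]
    · simp [Finset.card_univ]
      ring

theorem toOuterMeasure_marfeRun_not_accurate_le (hplan : IsOptimalPlanner s₀ plan)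
    (hgrp : IsEqualGrouping grp) {ε l : ℝ}
    (hε : 0 < ε) (hl : 1 ≤ l) (hβ : β = ε / (2 * (H : ℝ) ^ 2 * (Fintype.card S : ℝ)))
    (hm : 89 * ((Fintype.card S : ℝ) ^ 5 * (H : ℝ) ^ 6 * (Fintype.card A : ℝ) * l / ε ^ 2) ≤
      (m : ℝ)) (i : ℕ) (hi : i ≤ H) :
    (marfeRun P s₀ H β plan grp i hi).toOuterMeasure {Q | ¬Accurate P s₀ H β plan i Q} ≤
      ENNReal.ofReal (i * (Fintype.card S * Fintype.card A * 2 ^ Fintype.card S *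
        Real.exp (-l))) := by
  induction i with
  | zero =>
    have hempty : {Q | ¬Accurate P s₀ H β plan 0 Q} = ∅ :=
      Set.eq_empty_of_forall_notMem fun Q hQ => hQ fun h hh => absurd hh (Nat.not_lt_zero h)
    rw [hempty, MeasureTheory.measure_empty]
    exact zero_le
  | succ i ih =>
    rw [marfeRun, Nat.cast_succ, add_mul, one_mul,
      ENNReal.ofReal_add (by positivity) (by positivity)]
    refine (toOuterMeasure_bind_le _ _ (E := {Q | ¬Accurate P s₀ H β plan i Q})
      fun Q hQ => ?_).trans (add_le_add_left (ih (Nat.le_of_succ_le hi)) _)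
    have hQ' : Accurate P s₀ H β plan i Q := not_not.1 hQ
    rw [PMF.toOuterMeasure_map_apply]
    refine (MeasureTheory.OuterMeasure.mono _ fun D hD => ?_).trans
      ((toOuterMeasure_eq_ofReal_prob _ _).trans_le (ENNReal.ofReal_le_ofReal
        (hQ'.prob_phaseData_not_approximates_le hi hplan hgrp hε hl hβ hm)))
    exact fun h => hD (hQ'.update hplan h)

/-- The sample complexity of MARFE. -/
theorem one_sub_lt_prob_valuesClose (hH : 0 < H) (hplan : IsOptimalPlanner s₀ plan)
    (hgrp : IsEqualGrouping grp) {ε δ : ℝ} (hε : 0 < ε) (hδ : 0 < δ) (hδ' : δ ≤ 1)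
    (hm : 89 * ((Fintype.card S : ℝ) ^ 5 * (H : ℝ) ^ 6 * (Fintype.card A : ℝ) *
      (Real.log ((Fintype.card S : ℝ) * (H : ℝ) * (Fintype.card A : ℝ) / δ) +
        2 * (Fintype.card S : ℝ)) / ε ^ 2) ≤ (m : ℝ)) :
    1 - δ < prob (marfe P s₀ H (ε / (2 * (H : ℝ) ^ 2 * (Fintype.card S : ℝ))) plan grp)
      (ValuesClose H P s₀ (ε / 2)) := by
  have hS : (1 : ℝ) ≤ Fintype.card S := by exact_mod_cast Fintype.card_pos_iff.2 ⟨s₀⟩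
  have hA : (1 : ℝ) ≤ Fintype.card A := by exact_mod_cast Fintype.card_pos (α := A)
  have hH' : (1 : ℝ) ≤ H := by exact_mod_cast hH
  set β := ε / (2 * (H : ℝ) ^ 2 * (Fintype.card S : ℝ)) with hβ
  have hβ0 : 0 < β := by positivity
  set K := (Fintype.card S : ℝ) * (H : ℝ) * (Fintype.card A : ℝ) with hK
  have hK1 : 1 ≤ K :=
    one_le_mul_of_one_le_of_one_le (one_le_mul_of_one_le_of_one_le hS hH') hA
  have hlog : 0 ≤ Real.log (K / δ) :=
    Real.log_nonneg ((one_le_div hδ).2 (hδ'.trans hK1))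
  set l := Real.log (K / δ) + 2 * (Fintype.card S : ℝ) with hl
  set η := (H : ℝ) * (Fintype.card S * Fintype.card A * 2 ^ Fintype.card S * Real.exp (-l))
    with hη
  -- The term 2S in `l` contributes exp(-2S), which absorbs the 2^S subsets; strictness comes from 2
  -- exp(-2) < 1 and S ≥ 1.
  have hηδ : η < δ := by
    have hexp : Real.exp (-l) = δ / K * (Real.exp (-2)) ^ Fintype.card S := by
      rw [hl, neg_add, Real.exp_add, Real.exp_neg, Real.exp_log (by positivity), inv_div,
        ← Real.exp_nat_mul]
      ring_nf
    have hη' : η = δ * (2 * Real.exp (-2)) ^ Fintype.card S := by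
      rw [hη, hexp, mul_pow, hK]
      field_simp
    rw [hη']
    refine mul_lt_of_lt_one_right hδ (pow_lt_one₀ (by positivity) ?_
      (Fintype.card_pos_iff.2 ⟨s₀⟩).ne')
    have h2 : (2 : ℝ) < Real.exp 2 := by linarith [Real.add_one_le_exp 2]
    rw [Real.exp_neg, ← div_eq_mul_inv, div_lt_one (Real.exp_pos _)]
    exact h2
  have hclose : (H : ℝ) ^ 2 * (Fintype.card S * β) = ε / 2 := by
    rw [hβ]
    field_simp
  have hrun := toOuterMeasure_marfeRun_not_accurate_le (P := P) hplan hgrp hε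
    (by linarith : 1 ≤ l) hβ hm H le_rfl
  have hprob := one_sub_le_prob (marfe P s₀ H β plan grp) (F := ValuesClose H P s₀ (ε / 2))
    (by positivity : 0 ≤ η) hrun fun Q hQ => hclose ▸ hQ.valuesClose hH hplan hβ0
  linarith

end Run

end Marfe

theorem lemma1 :
    (∃ C : ℝ, 0 < C ∧
      ∀ (S A : Type*) [Fintype S] [DecidableEq S] [Fintype A] [DecidableEq A] [Nonempty A]
        (s₀ : S) (H : ℕ) (P : Marfe.Dynamics S A) (ε δ : ℝ) (m : ℕ)
        (plan : Marfe.Planner S A) (grp : Marfe.Grouping S A m),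
        0 < H → 0 < ε → ε < 1 → 0 < δ → δ < 1 →
        Marfe.IsOptimalPlanner s₀ plan → Marfe.IsEqualGrouping grp →
        C * ((Fintype.card S : ℝ) ^ 5 * (H : ℝ) ^ 6 * (Fintype.card A : ℝ) *
          (Real.log ((Fintype.card S : ℝ) * (H : ℝ) * (Fintype.card A : ℝ) / δ) +
            (Fintype.card S : ℝ)) / ε ^ 2) ≤ (m : ℝ) →
        1 - δ ≤ Marfe.prob
          (Marfe.marfe P s₀ H (ε / (2 * (H : ℝ) ^ 2 * (Fintype.card S : ℝ))) plan grp)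
          (Marfe.ValuesClose H P s₀ (ε / 2))) ∧
    (∀ (S A : Type*) [Fintype S] [DecidableEq S] [Fintype A] [DecidableEq A] [Nonempty A]
        (s₀ : S) (H : ℕ) (P : Marfe.Dynamics S A) (ε δ δ' : ℝ) (m M : ℕ)
        (plan : Marfe.Planner S A) (grp : Marfe.Grouping S A m),
        0 < H → 0 < ε → 0 < δ → m ≤ M →
        δ' = δ / ((Fintype.card S : ℝ) * (H : ℝ) * (Fintype.card A : ℝ)) * (1 / (M : ℝ)) →
        Marfe.IsOptimalPlanner s₀ plan → Marfe.IsEqualGrouping grp →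
        89 * ((Fintype.card S : ℝ) ^ 5 * (H : ℝ) ^ 6 * (Fintype.card A : ℝ) *
          (Real.log (1 / δ') + 2 * (Fintype.card S : ℝ)) / ε ^ 2) ≤ (m : ℝ) →
        1 - δ < Marfe.prob
          (Marfe.marfe P s₀ H (ε / (2 * (H : ℝ) ^ 2 * (Fintype.card S : ℝ))) plan grp)
          (Marfe.ValuesClose H P s₀ (2 * ε))) := by
  -- 178 = 2 · 89, because L + 2S ≤ 2(L + S) when the logarithm L is nonnegative.
  refine ⟨⟨178, by norm_num, ?_⟩, ?_⟩
  · intro S A _ _ _ _ _ s₀ H P ε δ m plan grp hH hε _ hδ hδ1 hplan hgrp hm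
    have hS : (1 : ℝ) ≤ Fintype.card S := by exact_mod_cast Fintype.card_pos_iff.2 ⟨s₀⟩
    have hA : (1 : ℝ) ≤ Fintype.card A := by exact_mod_cast Fintype.card_pos (α := A)
    have hH' : (1 : ℝ) ≤ H := by exact_mod_cast hH
    refine (Marfe.one_sub_lt_prob_valuesClose hH hplan hgrp hε hδ hδ1.le (le_trans ?_ hm)).le
    have hlog : 0 ≤ Real.log
        ((Fintype.card S : ℝ) * (H : ℝ) * (Fintype.card A : ℝ) / δ) :=
      Real.log_nonneg ((one_le_div hδ).2 (hδ1.le.trans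
        (one_le_mul_of_one_le_of_one_le (one_le_mul_of_one_le_of_one_le hS hH') hA)))
    set L := Real.log ((Fintype.card S : ℝ) * (H : ℝ) * (Fintype.card A : ℝ) / δ)
    set c := (Fintype.card S : ℝ) ^ 5 * (H : ℝ) ^ 6 * (Fintype.card A : ℝ) with hc
    have hc0 : 0 ≤ c := by positivity
    calc 89 * (c * (L + 2 * Fintype.card S) / ε ^ 2)
        ≤ 89 * (c * (2 * (L + Fintype.card S)) / ε ^ 2) := by
          gcongr
          linarith
      _ = 178 * (c * (L + Fintype.card S) / ε ^ 2) := by ring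
  · intro S A _ _ _ _ _ s₀ H P ε δ δ' m M plan grp hH hε hδ hmM hδ' hplan hgrp hm
    rcases lt_or_ge 1 δ with h1 | h1
    · exact (sub_neg.2 h1).trans_le ENNReal.toReal_nonneg
    have hS : (1 : ℝ) ≤ Fintype.card S := by exact_mod_cast Fintype.card_pos_iff.2 ⟨s₀⟩
    have hA : (1 : ℝ) ≤ Fintype.card A := by exact_mod_cast Fintype.card_pos (α := A)
    have hH' : (1 : ℝ) ≤ H := by exact_mod_cast hH
    -- With `M = 0` the conventions give `δ' = 0` and `log (1 / δ') = 0`, but the term 2S still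
    -- makes the required sample size positive while `m = 0`.
    have hM : M ≠ 0 := by
      rintro rfl
      obtain rfl := Nat.le_zero.1 hmM
      rw [hδ'] at hm
      simp only [Nat.cast_zero, div_zero, mul_zero, Real.log_zero, zero_add] at hm
      exact absurd hm (not_le.2 (by positivity))
    have hM1 : (1 : ℝ) ≤ M := by exact_mod_cast Nat.one_le_iff_ne_zero.2 hM
    have hlog : Real.log ((Fintype.card S : ℝ) * (H : ℝ) * (Fintype.card A : ℝ) / δ) ≤
        Real.log (1 / δ') := by
      refine Real.log_le_log (by positivity) ?_
      have heq : 1 / δ' = (Fintype.card S : ℝ) * (H : ℝ) * (Fintype.card A : ℝ) / δ * M := by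
        rw [hδ']
        field_simp
      rw [heq]
      exact le_mul_of_one_le_right (by positivity) hM1
    have hmain := Marfe.one_sub_lt_prob_valuesClose (P := P) hH hplan hgrp hε hδ h1
      (le_trans (by gcongr) hm)
    -- The main bound already gives ε/2, which is stronger than 2ε.
    refine hmain.trans_le (ENNReal.toReal_mono
      ((Marfe.toOuterMeasure_le_one _ _).trans_lt ENNReal.one_lt_top).ne
      (MeasureTheory.OuterMeasure.mono _ fun Q hQ π r hr => (hQ π r hr).trans (by linarith)))
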